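/- **Proposition (the nearest odd algorithm has the finite building property).** Call $a = x+y\mathrm{i} \in \mathbb{Z}[\mathrm{i}]$ *odd* if $x+y$ is odd. Let $\langle\cdot\rangle : \mathbb{C}\setminus\{0\} \to \mathbb{Z}[\mathrm{i}]$ be a *nearest odd* function: for each $z \neq 0$, $\langle z\rangle$ is an odd Gaussian integer closest to $z$ among all odd Gaussian integers (with ties broken in any way). Let $$K = \overline{\{\, z - \langle z\rangle : z \in \mathbb{C}\setminus\{0\} \,\}}, \qquad G(z) = -\tfrac1z - \big\langle -\tfrac1z \big\rangle \ \ (z \in K,\ z\neq 0), \qquad G(0) = 0 .$$ Then $\langle\cdot\rangle$ is a choice function, that is, $|z - \langle z\rangle| \le 1$ for all $z \ne 0$; its fundamental set is the diamond $K = \{ z : |\operatorname{Re} z| + |\operatorname{Im} z| \le 1 \}$; the Gauss map $G$ maps $K$ into $K$; and the algorithm satisfies the finite building property with the partition $\mathcal{P} = \{K_1, \ldots, K_{12}\}$ given by $$\begin{aligned} K_1 &= \{ z \in K : |z-\tfrac{-1-\mathrm{i}}2| \le \tfrac1{\sqrt2},\ |z-\tfrac{-1+\mathrm{i}}2| \le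 \tfrac1{\sqrt2} \}, \\ K_2 &= \{ z \in K : |z-\tfrac{-1-\mathrm{i}}2| \ge \tfrac1{\sqrt2},\ 0 \le \operatorname{Im} z \le -\operatorname{Re} z \}, \\ K_3 &= \{ z \in K : |z-\tfrac{1+\mathrm{i}}2| \ge \tfrac1{\sqrt2},\ -\operatorname{Im} z \le \operatorname{Re} z \le 0 \}, \\ K_i &= -\mathrm{i}\,K_{i-3} \quad (i = 4,\ldots,12). \end{aligned}$$ This means the following. The sets $K_1,\ldots,K_{12}$ are closed, have non-empty interiors and boundaries of Lebesgue measure zero, their union is $K$, and the interiors of $K_i$ and $K_j$ are disjoint for $i \neq j$. Moreover, each image $G(K_i)$, $1 \le i \le 12$, is buildable from $\mathcal{P}$: there is a set $J_i \subseteq \{1,\ldots,12\}$ such that $G(K_i)$ and $\bigcup_{j\in J_i} K_j$ differ by a set of Lebesgue measure zero. -/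

import Mathlib

open MeasureTheory

noncomputable section

namespace ComplexCF

/-- A choice function `ℂ ∖ {0} → ℤ[i]`. It is given as a function on all of `ℂ`, but its value
at `0` is never used anywhere below. -/
def IsChoiceFunction (c : ℂ → GaussianInt) : Prop :=
  ∀ z : ℂ, z ≠ 0 → ‖z - (c z : ℂ)‖ ≤ 1

/-- The fundamental set `K` of a choice function. -/
def fundamentalSet (c : ℂ → GaussianInt) : Set ℂ :=
  closure {w : ℂ | ∃ z : ℂ, z ≠ 0 ∧ w = z - (c z : ℂ)}

open scoped Classical in
/-- The Gauss map `G(z) = -1/z - ⟨-1/z⟩` for `z ≠ 0`, and `G(0) = 0`. -/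
def gaussMap (c : ℂ → GaussianInt) (z : ℂ) : ℂ :=
  if z = 0 then 0 else -1 / z - (c (-1 / z) : ℂ)

/-- `X` is equal, up to Lebesgue measure zero, to a union of elements of `C`. -/
def IsBuildable (C : Set (Set ℂ)) (X : Set ℂ) : Prop :=
  ∃ D : Set (Set ℂ), D ⊆ C ∧ X =ᵐ[volume] ⋃₀ D

/-- `P` is a finite partition of `K` into closed pieces whose boundaries have measure zero, where
only the interiors of different pieces have to be disjoint. Every piece has non-empty interior
(so that the `N` pieces are distinct and none of them is degenerate). -/
structure IsFinitePartition (K : Set ℂ) {N : ℕ} (P : Fin N → Set ℂ) : Prop where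
  iUnion_eq : ⋃ i, P i = K
  isClosed : ∀ i, IsClosed (P i)
  frontier_null : ∀ i, volume (frontier (P i)) = 0
  interior_nonempty : ∀ i, (interior (P i)).Nonempty
  interior_disjoint : ∀ i j, i ≠ j → Disjoint (interior (P i)) (interior (P j))

/-- The continued fraction algorithm with choice function `c` satisfies the finite building
property with the partition `P = {K_1, …, K_N}` of its fundamental set. -/
structure FiniteBuildingPropertyWith (c : ℂ → GaussianInt) {N : ℕ} (P : Fin N → Set ℂ) :
    Prop where
  choice : IsChoiceFunction c
  gauss_mapsTo : Set.MapsTo (gaussMap c) (fundamentalSet c) (fundamentalSet c)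
  one_lt : 1 < N
  partition : IsFinitePartition (fundamentalSet c) P
  buildable : ∀ i, IsBuildable (Set.range P) (gaussMap c '' P i)

/-- A Gaussian integer `x + y i` is odd if `x + y` is odd. -/
def IsOddGaussian (a : GaussianInt) : Prop := Odd (a.re + a.im)

/-- `c` is a nearest odd algorithm: it sends each `z ≠ 0` to an odd Gaussian integer that is
closest to `z` among all odd Gaussian integers. Ties may be broken in any way. -/
def IsNearestOdd (c : ℂ → GaussianInt) : Prop :=
  ∀ z : ℂ, z ≠ 0 → IsOddGaussian (c z) ∧
    ∀ b : GaussianInt, IsOddGaussian b → ‖z - (c z : ℂ)‖ ≤ ‖z - (b : ℂ)‖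

/-- The diamond with corners `±1`, `±i`. -/
def diamond : Set ℂ := {z : ℂ | |z.re| + |z.im| ≤ 1}

/-- The pieces `K_1, K_2, …` of the diamond, numbered from `0`: `noPiece i` is `K_{i+1}`. From the
fourth one on, `K_i = -i K_{i-3}`. -/
def noPiece : ℕ → Set ℂ
  | 0 => {z : ℂ | z ∈ diamond ∧ ‖z - (-1 - Complex.I) / 2‖ ≤ 1 / √2 ∧
      ‖z - (-1 + Complex.I) / 2‖ ≤ 1 / √2}
  | 1 => {z : ℂ | z ∈ diamond ∧ 1 / √2 ≤ ‖z - (-1 - Complex.I) / 2‖ ∧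
      0 ≤ z.im ∧ z.im ≤ -z.re}
  | 2 => {z : ℂ | z ∈ diamond ∧ 1 / √2 ≤ ‖z - (1 + Complex.I) / 2‖ ∧
      -z.im ≤ z.re ∧ z.re ≤ 0}
  | n + 3 => (fun z : ℂ => -Complex.I * z) '' noPiece n

/-- The family `K_1, …, K_12`. -/
def noPartition (i : Fin 12) : Set ℂ := noPiece i

end ComplexCF

end

namespace ComplexCF

open Complex

/-! The translates of the diamond by odd Gaussian integers tile the plane, and nearest odd rounding
selects the tile containing the point (`sub_mem_diamond_of_nearest`, `eq_of_sub_mem_openDiamond`).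
Ties occur only on tile edges, so off a null set `gaussMap c '' X` equals `oddTransfer X`, which
does not mention `c` (`mem_gaussMap_image_iff`).

The map `-1/z` straightens the circular edges of the pieces, since these circles pass through 0. It
sends `K_1` to a region containing the whole open tile about 3, and `K_2`, `K_3` into strips of
slope 1 that cut tiles along a diagonal. Hence the images are, almost everywhere, the full diamond
and its halves `re ≤ im` and `im ≤ re`; each half is a union of six pieces. The other nine cases
follow by quarter turns, which preserve oddness and permute the pieces. -/

/-- The open diamond with corners `±1`, `±i`. -/
def openDiamond : Set ℂ := {z : ℂ | |z.re| + |z.im| < 1}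

/-- The points `w` for which some odd translate `w + a` is of the form `-1 / x` with `x ∈ X`. -/
def oddTransfer (X : Set ℂ) : Set ℂ :=
  {w : ℂ | ∃ a : GaussianInt, IsOddGaussian a ∧ ∃ x ∈ X, x * (w + (a : ℂ)) = -1}

/-! ### The diamond -/

theorem isOpen_openDiamond : IsOpen openDiamond :=
  isOpen_lt (by fun_prop) (by fun_prop)

theorem isClosed_diamond : IsClosed diamond :=
  isClosed_le (by fun_prop) (by fun_prop)

theorem openDiamond_subset_diamond : openDiamond ⊆ diamond := fun z hz =>
  le_of_lt (show |z.re| + |z.im| < 1 from hz)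

theorem convex_diamond : Convex ℝ diamond := by
  intro z hz w hw a b ha hb hab
  simp only [diamond, Set.mem_ofPred_eq, add_re, add_im, real_smul, re_ofReal_mul,
    im_ofReal_mul] at *
  have h1 := abs_add_le (a * z.re) (b * w.re)
  have h2 := abs_add_le (a * z.im) (b * w.im)
  simp only [abs_mul, abs_of_nonneg ha, abs_of_nonneg hb] at h1 h2
  nlinarith

theorem convex_openDiamond : Convex ℝ openDiamond := by
  intro z hz w hw a b ha hb hab
  simp only [openDiamond, Set.mem_ofPred_eq, add_re, add_im, real_smul, re_ofReal_mul,
    im_ofReal_mul] at *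
  have h1 := abs_add_le (a * z.re) (b * w.re)
  have h2 := abs_add_le (a * z.im) (b * w.im)
  simp only [abs_mul, abs_of_nonneg ha, abs_of_nonneg hb] at h1 h2
  rcases ha.eq_or_lt with rfl | ha
  · have : b = 1 := by linarith
    subst this
    linarith
  · nlinarith

theorem closure_openDiamond : closure openDiamond = diamond := by
  refine subset_antisymm
    (closure_minimal openDiamond_subset_diamond isClosed_diamond) fun z hz => ?_
  have hcont : ContinuousWithinAt (fun t : ℝ => (t : ℂ) * z) (Set.Ioo 0 1) 1 :=
    (by fun_prop : Continuous fun t : ℝ => (t : ℂ) * z).continuousWithinAt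
  have hmem : (1 : ℝ) ∈ closure (Set.Ioo (0 : ℝ) 1) := by
    rw [closure_Ioo zero_ne_one]
    simp
  have := hcont.mem_closure (t := openDiamond) hmem (fun t ht => ?_)
  · simpa using this
  · simp only [openDiamond, diamond, Set.mem_ofPred_eq, re_ofReal_mul, im_ofReal_mul, abs_mul,
      abs_of_pos ht.1] at *
    nlinarith [ht.1, ht.2]

theorem volume_diamond_diff_openDiamond : volume (diamond \ openDiamond) = 0 := by
  have h := convex_openDiamond.addHaar_frontier volume
  rwa [isOpen_openDiamond.frontier_eq, closure_openDiamond] at h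

theorem mem_diamond_iff (z : ℂ) : z ∈ diamond ↔
    z.re + z.im ≤ 1 ∧ z.re - z.im ≤ 1 ∧ -z.re + z.im ≤ 1 ∧ -z.re - z.im ≤ 1 := by
  simp only [diamond, Set.mem_ofPred_eq]
  grind

theorem mem_openDiamond_iff (z : ℂ) : z ∈ openDiamond ↔
    z.re + z.im < 1 ∧ z.re - z.im < 1 ∧ -z.re + z.im < 1 ∧ -z.re - z.im < 1 := by
  simp only [openDiamond, Set.mem_ofPred_eq]
  grind

theorem norm_le_one_of_mem_diamond {z : ℂ} (hz : z ∈ diamond) : ‖z‖ ≤ 1 :=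
  (Complex.norm_le_abs_re_add_abs_im z).trans hz

theorem I_mul_mem_diamond_iff (z : ℂ) : I * z ∈ diamond ↔ z ∈ diamond := by
  simp only [mem_diamond_iff, I_mul_re, I_mul_im]
  grind

/-! ### Nearest odd Gaussian integers -/

theorem norm_le_norm_iff_re_im (z w : ℂ) :
    ‖z‖ ≤ ‖w‖ ↔ z.re ^ 2 + z.im ^ 2 ≤ w.re ^ 2 + w.im ^ 2 := by
  rw [← sq_le_sq₀ (norm_nonneg z) (norm_nonneg w), Complex.sq_norm, Complex.sq_norm,
    normSq_apply, normSq_apply]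
  simp only [sq]

/-- The sides of the diamond about `a` lie on the perpendicular bisectors between `a` and its odd
neighbours `a ± 1 ± i`. -/
theorem sub_mem_diamond_of_nearest {z : ℂ} {a : GaussianInt} (ha : IsOddGaussian a)
    (h : ∀ b : GaussianInt, IsOddGaussian b → ‖z - (a : ℂ)‖ ≤ ‖z - (b : ℂ)‖) :
    z - (a : ℂ) ∈ diamond := by
  have key : ∀ s t : ℤ, Even (s + t) →
      (z.re - a.re) ^ 2 + (z.im - a.im) ^ 2 ≤
        (z.re - (a.re + s)) ^ 2 + (z.im - (a.im + t)) ^ 2 := by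
    intro s t hst
    have := h ⟨a.re + s, a.im + t⟩ (by
      have : Odd (a.re + a.im + (s + t)) := ha.add_even hst
      unfold IsOddGaussian
      convert this using 1
      ring)
    rw [norm_le_norm_iff_re_im] at this
    simpa using this
  have h1 := key 1 1 (by decide)
  have h2 := key 1 (-1) (by decide)
  have h3 := key (-1) 1 (by decide)
  have h4 := key (-1) (-1) (by decide)
  push_cast at h1 h2 h3 h4
  rw [mem_diamond_iff]
  simp only [sub_re, sub_im, ← GaussianInt.intCast_re,
    ← GaussianInt.intCast_im]
  refine ⟨?_, ?_, ?_, ?_⟩ <;> nlinarith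

/-- In the coordinates `re + im` and `re - im` the tiles are squares of side 2. Both coordinates of
`a` and `b` are odd and differ by less than 2, so they agree. -/
theorem eq_of_sub_mem_openDiamond {z : ℂ} {a b : GaussianInt} (ha : IsOddGaussian a)
    (hb : IsOddGaussian b) (hza : z - (a : ℂ) ∈ openDiamond) (hzb : z - (b : ℂ) ∈ diamond) :
    b = a := by
  rw [mem_openDiamond_iff] at hza
  rw [mem_diamond_iff] at hzb
  simp only [sub_re, sub_im, ← GaussianInt.intCast_re,
    ← GaussianInt.intCast_im] at hza hzb
  obtain ⟨a1, a2, a3, a4⟩ := hza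
  obtain ⟨b1, b2, b3, b4⟩ := hzb
  have h1 : (a.re + a.im) - (b.re + b.im) < 2 := by
    have : (((a.re + a.im) - (b.re + b.im) : ℤ) : ℝ) < (2 : ℤ) := by push_cast; linarith
    exact_mod_cast this
  have h2 : (b.re + b.im) - (a.re + a.im) < 2 := by
    have : (((b.re + b.im) - (a.re + a.im) : ℤ) : ℝ) < (2 : ℤ) := by push_cast; linarith
    exact_mod_cast this
  have h3 : (a.re - a.im) - (b.re - b.im) < 2 := by
    have : (((a.re - a.im) - (b.re - b.im) : ℤ) : ℝ) < (2 : ℤ) := by push_cast; linarith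
    exact_mod_cast this
  have h4 : (b.re - b.im) - (a.re - a.im) < 2 := by
    have : (((b.re - b.im) - (a.re - a.im) : ℤ) : ℝ) < (2 : ℤ) := by push_cast; linarith
    exact_mod_cast this
  obtain ⟨k, hk⟩ := ha
  obtain ⟨l, hl⟩ := hb
  apply Zsqrtd.ext <;> omega

namespace IsNearestOdd

variable {c : ℂ → GaussianInt}

theorem sub_mem_diamond (hc : IsNearestOdd c) {z : ℂ} (hz : z ≠ 0) :
    z - (c z : ℂ) ∈ diamond :=
  sub_mem_diamond_of_nearest (hc z hz).1 (hc z hz).2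

theorem eq_of_mem_openDiamond (hc : IsNearestOdd c) {z : ℂ} (hz : z ≠ 0) {a : GaussianInt}
    (ha : IsOddGaussian a) (h : z - (a : ℂ) ∈ openDiamond) : c z = a :=
  eq_of_sub_mem_openDiamond ha (hc z hz).1 h (hc.sub_mem_diamond hz)

theorem isChoiceFunction (hc : IsNearestOdd c) : IsChoiceFunction c := fun _ hz =>
  norm_le_one_of_mem_diamond (hc.sub_mem_diamond hz)

theorem fundamentalSet_eq (hc : IsNearestOdd c) : fundamentalSet c = diamond := by
  refine subset_antisymm (closure_minimal ?_ isClosed_diamond) ?_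
  · rintro _ ⟨z, hz, rfl⟩
    exact hc.sub_mem_diamond hz
  · rw [← closure_openDiamond]
    -- Any odd centre would serve; with centre 1 the point `w + 1` is nonzero because `-1` is a
    -- corner, not in the open diamond.
    refine closure_mono fun w hw => ⟨w + 1, fun h => ?_, ?_⟩
    · rw [eq_neg_of_add_eq_zero_left h] at hw
      simp [openDiamond] at hw
    · have hw1 : w + 1 ≠ 0 := fun h => by
        rw [eq_neg_of_add_eq_zero_left h] at hw
        simp [openDiamond] at hw
      rw [hc.eq_of_mem_openDiamond hw1 (a := 1) (by simp [IsOddGaussian]) (by simpa using hw)]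
      simp

theorem gaussMap_mem_diamond (hc : IsNearestOdd c) (z : ℂ) : gaussMap c z ∈ diamond := by
  unfold gaussMap
  split_ifs with h
  · simp [diamond]
  · exact hc.sub_mem_diamond (by simp [h])

/-- Inside an open tile the nearest odd integer is unique, so tie-breaking plays no role. Excluding
`w = 0` discards the conventional value at 0. -/
theorem mem_gaussMap_image_iff (hc : IsNearestOdd c) (X : Set ℂ) {w : ℂ}
    (hw : w ∈ openDiamond) (hw0 : w ≠ 0) : w ∈ gaussMap c '' X ↔ w ∈ oddTransfer X := by
  constructor
  · rintro ⟨x, hx, rfl⟩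
    have hx0 : x ≠ 0 := by
      rintro rfl
      simp [gaussMap] at hw0
    refine ⟨c (-1 / x), (hc _ (by simp [hx0])).1, x, hx, ?_⟩
    simp only [gaussMap, hx0, if_false]
    field_simp
    ring
  · rintro ⟨a, ha, x, hx, h⟩
    have hx0 : x ≠ 0 := by
      rintro rfl
      simp at h
    have hT : -1 / x = w + (a : ℂ) := by
      field_simp
      rw [← h]
    refine ⟨x, hx, ?_⟩
    have hne : -1 / x ≠ 0 := by simp [hx0]
    have := hc.eq_of_mem_openDiamond hne ha (by rw [hT]; simpa using hw)
    simp only [gaussMap, hx0, if_false, this]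
    rw [hT]
    ring

end IsNearestOdd

/-! ### The pieces in coordinates -/

/-- The circle passes through 0, so the constant terms cancel. -/
theorem norm_sub_half_le_iff (z : ℂ) (p : ℂ) (hp : p.re ^ 2 + p.im ^ 2 = 2) :
    ‖z - p / 2‖ ≤ 1 / √2 ↔ z.re ^ 2 + z.im ^ 2 ≤ p.re * z.re + p.im * z.im := by
  have h2 : (1 / √2) ^ 2 = (1 / 2 : ℝ) := by
    rw [div_pow, Real.sq_sqrt (by norm_num)]
    norm_num
  rw [← sq_le_sq₀ (norm_nonneg _) (by positivity), h2, Complex.sq_norm, normSq_apply]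
  simp only [sub_re, sub_im, div_ofNat_re, div_ofNat_im]
  constructor <;> intro h <;> nlinarith

theorem le_norm_sub_half_iff (z : ℂ) (p : ℂ) (hp : p.re ^ 2 + p.im ^ 2 = 2) :
    1 / √2 ≤ ‖z - p / 2‖ ↔ p.re * z.re + p.im * z.im ≤ z.re ^ 2 + z.im ^ 2 := by
  have h2 : (1 / √2) ^ 2 = (1 / 2 : ℝ) := by
    rw [div_pow, Real.sq_sqrt (by norm_num)]
    norm_num
  rw [← sq_le_sq₀ (by positivity) (norm_nonneg _), h2, Complex.sq_norm, normSq_apply]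
  simp only [sub_re, sub_im, div_ofNat_re, div_ofNat_im]
  constructor <;> intro h <;> nlinarith

theorem mem_noPiece_zero (z : ℂ) : z ∈ noPiece 0 ↔ z ∈ diamond ∧
    z.re ^ 2 + z.im ^ 2 ≤ -z.re - z.im ∧ z.re ^ 2 + z.im ^ 2 ≤ -z.re + z.im := by
  simp only [noPiece, Set.mem_ofPred_eq]
  rw [norm_sub_half_le_iff _ _ (by norm_num), norm_sub_half_le_iff _ _ (by norm_num)]
  simp [sub_eq_add_neg]

theorem mem_noPiece_one (z : ℂ) : z ∈ noPiece 1 ↔ z ∈ diamond ∧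
    -z.re - z.im ≤ z.re ^ 2 + z.im ^ 2 ∧ 0 ≤ z.im ∧ z.im ≤ -z.re := by
  simp only [noPiece, Set.mem_ofPred_eq]
  rw [le_norm_sub_half_iff _ _ (by norm_num)]
  simp [sub_eq_add_neg]

theorem mem_noPiece_two (z : ℂ) : z ∈ noPiece 2 ↔ z ∈ diamond ∧
    z.re + z.im ≤ z.re ^ 2 + z.im ^ 2 ∧ -z.im ≤ z.re ∧ z.re ≤ 0 := by
  simp only [noPiece, Set.mem_ofPred_eq]
  rw [le_norm_sub_half_iff _ _ (by norm_num)]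
  simp

theorem mem_noPiece_add_three (n : ℕ) (z : ℂ) : z ∈ noPiece (n + 3) ↔ I * z ∈ noPiece n := by
  simp only [noPiece, Set.mem_image]
  constructor
  · rintro ⟨w, hw, rfl⟩
    rwa [← mul_assoc, mul_neg, I_mul_I, neg_neg, one_mul]
  · intro h
    refine ⟨_, h, ?_⟩
    rw [← mul_assoc, neg_mul, I_mul_I, neg_neg, one_mul]

theorem mem_noPiece_add_nine (n : ℕ) (z : ℂ) : z ∈ noPiece (n + 9) ↔ -I * z ∈ noPiece n := by
  rw [mem_noPiece_add_three (n + 6), mem_noPiece_add_three (n + 3), mem_noPiece_add_three]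
  rw [show I * (I * (I * z)) = -I * z by linear_combination I * z * I_mul_I]

theorem noPiece_add_twelve (n : ℕ) : noPiece (n + 12) = noPiece n := by
  ext z
  rw [mem_noPiece_add_three (n + 9), mem_noPiece_add_nine]
  rw [show -I * (I * z) = z by linear_combination -z * I_mul_I]

theorem noPiece_mod_twelve (n : ℕ) : noPiece (n % 12) = noPiece n := by
  induction n using Nat.strong_induction_on with
  | _ n ih =>
    rcases lt_or_ge n 12 with h | h
    · rw [Nat.mod_eq_of_lt h]
    · obtain ⟨m, rfl⟩ := Nat.exists_eq_add_of_le' h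
      rw [Nat.add_mod_right, noPiece_add_twelve, ih m (by omega)]

theorem noPiece_mem_range_noPartition (n : ℕ) : noPiece n ∈ Set.range noPartition :=
  ⟨⟨n % 12, Nat.mod_lt _ (by norm_num)⟩, noPiece_mod_twelve n⟩

/-! ### Covering the diamond and its two halves by pieces -/

theorem noPiece_subset_diamond (n : ℕ) : noPiece n ⊆ diamond := by
  induction n using noPiece.induct with
  | case1 => exact fun z hz => hz.1
  | case2 => exact fun z hz => hz.1
  | case3 => exact fun z hz => hz.1
  | case4 n ih =>
    intro z hz
    rw [mem_noPiece_add_three] at hz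
    exact (I_mul_mem_diamond_iff z).1 (ih hz)

/-- Coverage of the octant `0 ≤ im ≤ -re` of the diamond. -/
theorem mem_noPiece_of_im_le_neg_re {z : ℂ} (hz : z ∈ diamond) (h0 : 0 ≤ z.im)
    (h1 : z.im ≤ -z.re) : z ∈ noPiece 0 ∨ z ∈ noPiece 1 := by
  rw [mem_noPiece_zero, mem_noPiece_one]
  rcases le_total (-z.re - z.im) (z.re ^ 2 + z.im ^ 2) with h | h
  · exact Or.inr ⟨hz, h, h0, h1⟩
  · exact Or.inl ⟨hz, h, by linarith⟩

/-- Coverage of the octant `-im ≤ re ≤ 0` of the diamond. -/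
theorem mem_noPiece_of_neg_im_le_re {z : ℂ} (hz : z ∈ diamond) (h0 : z.re ≤ 0)
    (h1 : -z.im ≤ z.re) : z ∈ noPiece 2 ∨ z ∈ noPiece 3 := by
  rw [mem_noPiece_two, mem_noPiece_add_three 0, mem_noPiece_zero, I_mul_mem_diamond_iff]
  rw [I_mul_re, I_mul_im]
  rcases le_total (z.re + z.im) (z.re ^ 2 + z.im ^ 2) with h | h
  · exact Or.inl ⟨hz, h, h1, h0⟩
  · exact Or.inr ⟨hz, by linarith, by linarith⟩

/-- The half consists of four octants, each covered by two pieces after a rotation. The lenses 0 and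
3 straddle the axes and each serve two octants, so six pieces suffice. -/
theorem mem_iUnion_noPiece_of_re_le_im {z : ℂ} (hz : z ∈ diamond) (h : z.re ≤ z.im) :
    ∃ n ∈ ({0, 1, 2, 3, 4, 11} : Set ℕ), z ∈ noPiece n := by
  rcases le_total z.re 0 with hx | hx <;> rcases le_total z.im 0 with hy | hy
  · have := mem_noPiece_of_neg_im_le_re (z := -I * z)
      (by rw [← I_mul_mem_diamond_iff, ← mul_assoc]; simpa using hz) (by simpa using hy)
      (by simpa using h)
    rw [← mem_noPiece_add_nine, ← mem_noPiece_add_nine, noPiece_add_twelve 0] at this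
    rcases this with h | h
    · exact ⟨11, by simp, h⟩
    · exact ⟨0, by simp, h⟩
  · rcases le_total z.im (-z.re) with h | h
    · rcases mem_noPiece_of_im_le_neg_re hz hy h with h | h
      · exact ⟨0, by simp, h⟩
      · exact ⟨1, by simp, h⟩
    · rcases mem_noPiece_of_neg_im_le_re hz hx (by linarith) with h | h
      · exact ⟨2, by simp, h⟩
      · exact ⟨3, by simp, h⟩
  -- In this quadrant `re ≤ im` leaves only the origin.
  · have hx0 : z.re = 0 := by linarith
    have hy0 : z.im = 0 := by linarith
    exact ⟨0, by simp, by rw [mem_noPiece_zero]; exact ⟨hz, by simp [hx0, hy0]⟩⟩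
  · have := mem_noPiece_of_im_le_neg_re (z := I * z) ((I_mul_mem_diamond_iff z).2 hz)
      (by simpa using hx) (by simpa using h)
    rw [← mem_noPiece_add_three, ← mem_noPiece_add_three] at this
    rcases this with h | h
    · exact ⟨3, by simp, h⟩
    · exact ⟨4, by simp, h⟩

theorem mem_iUnion_noPiece_of_im_le_re {z : ℂ} (hz : z ∈ diamond) (h : z.im ≤ z.re) :
    ∃ n ∈ ({5, 6, 7, 8, 9, 10} : Set ℕ), z ∈ noPiece n := by
  -- Multiplying twice by `I` is the half turn exchanging the halves; it shifts indices by 6.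
  obtain ⟨n, hn, hzn⟩ := mem_iUnion_noPiece_of_re_le_im (z := I * (I * z))
    (by simpa only [I_mul_mem_diamond_iff] using hz) (by simpa using h)
  rw [← mem_noPiece_add_three, ← mem_noPiece_add_three] at hzn
  simp only [Set.mem_insert_iff, Set.mem_singleton_iff] at hn
  rcases hn with rfl | rfl | rfl | rfl | rfl | rfl
  · exact ⟨6, by simp, hzn⟩
  · exact ⟨7, by simp, hzn⟩
  · exact ⟨8, by simp, hzn⟩
  · exact ⟨9, by simp, hzn⟩
  · exact ⟨10, by simp, hzn⟩
  · exact ⟨5, by simp, by rwa [← noPiece_add_twelve]⟩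

theorem re_le_im_of_mem_noPiece {z : ℂ} {n : ℕ} (hn : n ∈ ({0, 1, 2, 3, 4, 11} : Set ℕ))
    (hz : z ∈ noPiece n) : z.re ≤ z.im := by
  have h1 := sq_nonneg z.re
  have h2 := sq_nonneg z.im
  simp only [Set.mem_insert_iff, Set.mem_singleton_iff] at hn
  rcases hn with rfl | rfl | rfl | rfl | rfl | rfl
  all_goals
    simp only [mem_noPiece_add_nine 2, mem_noPiece_add_three 0, mem_noPiece_add_three 1,
      mem_noPiece_zero, mem_noPiece_one, mem_noPiece_two, I_mul_re, I_mul_im, neg_mul, neg_re,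
      neg_im, neg_sq] at hz
    linarith [hz.2.1, hz.2.2]

theorem im_le_re_of_mem_noPiece {z : ℂ} {n : ℕ} (hn : n ∈ ({5, 6, 7, 8, 9, 10} : Set ℕ))
    (hz : z ∈ noPiece n) : z.im ≤ z.re := by
  have key : ∃ m ∈ ({0, 1, 2, 3, 4, 11} : Set ℕ), I * (I * z) ∈ noPiece m := by
    simp only [← mem_noPiece_add_three]
    simp only [Set.mem_insert_iff, Set.mem_singleton_iff] at hn
    rcases hn with rfl | rfl | rfl | rfl | rfl | rfl
    · exact ⟨11, by simp, by rwa [← noPiece_add_twelve] at hz⟩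
    · exact ⟨0, by simp, hz⟩
    · exact ⟨1, by simp, hz⟩
    · exact ⟨2, by simp, hz⟩
    · exact ⟨3, by simp, hz⟩
    · exact ⟨4, by simp, hz⟩
  obtain ⟨m, hm, hzm⟩ := key
  simpa using re_le_im_of_mem_noPiece hm hzm

theorem exists_mem_noPiece {z : ℂ} (hz : z ∈ diamond) : ∃ n, z ∈ noPiece n := by
  rcases le_total z.re z.im with h | h
  · obtain ⟨n, -, hn⟩ := mem_iUnion_noPiece_of_re_le_im hz h
    exact ⟨n, hn⟩
  · obtain ⟨n, -, hn⟩ := mem_iUnion_noPiece_of_im_le_re hz h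
    exact ⟨n, hn⟩

/-! ### Images under the Gauss map -/

section Inversion

variable {x w : ℂ}

/-- These are the coordinates of `x = -conj w / |w|²`, cleared of denominators. -/
theorem inversion_coords (h : x * w = -1) : 0 < w.re ^ 2 + w.im ^ 2 ∧
    x.re * (w.re ^ 2 + w.im ^ 2) = -w.re ∧ x.im * (w.re ^ 2 + w.im ^ 2) = w.im ∧
    (x.re ^ 2 + x.im ^ 2) * (w.re ^ 2 + w.im ^ 2) = 1 := by
  have hre := congrArg re h
  have him := congrArg im h
  simp only [mul_re, mul_im, neg_re, neg_im, one_re, one_im, neg_zero] at hre him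
  have hn : (x.re ^ 2 + x.im ^ 2) * (w.re ^ 2 + w.im ^ 2) = 1 := by
    linear_combination (x.re * w.re - x.im * w.im - 1) * hre +
      (x.re * w.im + x.im * w.re) * him
  refine ⟨?_, by linear_combination w.re * hre + w.im * him,
    by linear_combination w.re * him - w.im * hre, hn⟩
  by_contra! hle
  nlinarith [sq_nonneg x.re, sq_nonneg x.im]

theorem inversion_linear_le_iff (h : x * w = -1) (p q r : ℝ) :
    p * x.re + q * x.im ≤ r ↔ q * w.im - p * w.re ≤ r * (w.re ^ 2 + w.im ^ 2) := by
  obtain ⟨hs, h1, h2, -⟩ := inversion_coords h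
  rw [← mul_le_mul_iff_left₀ hs]
  rw [show (p * x.re + q * x.im) * (w.re ^ 2 + w.im ^ 2) = q * w.im - p * w.re by
    linear_combination p * h1 + q * h2]

/-- Multiplication by `|w|²` turns `|x|²` into 1: inversion sends a circle through 0 to a line. -/
theorem inversion_sq_le_iff (h : x * w = -1) (p q : ℝ) :
    x.re ^ 2 + x.im ^ 2 ≤ p * x.re + q * x.im ↔ 1 ≤ q * w.im - p * w.re := by
  obtain ⟨hs, h1, h2, h3⟩ := inversion_coords h
  rw [← mul_le_mul_iff_left₀ hs, h3]
  rw [show (p * x.re + q * x.im) * (w.re ^ 2 + w.im ^ 2) = q * w.im - p * w.re by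
    linear_combination p * h1 + q * h2]

theorem inversion_le_sq_iff (h : x * w = -1) (p q : ℝ) :
    p * x.re + q * x.im ≤ x.re ^ 2 + x.im ^ 2 ↔ q * w.im - p * w.re ≤ 1 := by
  obtain ⟨hs, h1, h2, h3⟩ := inversion_coords h
  rw [← mul_le_mul_iff_left₀ hs, h3]
  rw [show (p * x.re + q * x.im) * (w.re ^ 2 + w.im ^ 2) = q * w.im - p * w.re by
    linear_combination p * h1 + q * h2]

/-- The four sides of the diamond invert to circles through 0, so `w` must avoid four open discs. -/
theorem inversion_mem_diamond (h : x * w = -1)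
    (h1 : w.re + w.im ≤ w.re ^ 2 + w.im ^ 2) (h2 : w.re - w.im ≤ w.re ^ 2 + w.im ^ 2)
    (h3 : -w.re + w.im ≤ w.re ^ 2 + w.im ^ 2) (h4 : -w.re - w.im ≤ w.re ^ 2 + w.im ^ 2) :
    x ∈ diamond := by
  rw [mem_diamond_iff]
  have e1 := (inversion_linear_le_iff h 1 1 1).2 (by linarith)
  have e2 := (inversion_linear_le_iff h 1 (-1) 1).2 (by linarith)
  have e3 := (inversion_linear_le_iff h (-1) 1 1).2 (by linarith)
  have e4 := (inversion_linear_le_iff h (-1) (-1) 1).2 (by linarith)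
  refine ⟨?_, ?_, ?_, ?_⟩ <;> linarith

end Inversion

theorem exists_mul_eq_neg_one {w : ℂ} (hw : 0 < w.re) : ∃ x, x * w = -1 := by
  have hw0 : w ≠ 0 := by
    rintro rfl
    simp at hw
  exact ⟨-1 / w, by field_simp⟩

theorem openDiamond_subset_oddTransfer_noPiece_zero :
    openDiamond ⊆ oddTransfer (noPiece 0) := by
  intro w hw
  rw [mem_openDiamond_iff] at hw
  obtain ⟨w1, w2, w3, w4⟩ := hw
  have hre : (w + ((⟨3, 0⟩ : GaussianInt) : ℂ)).re = w.re + 3 := by simp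
  have him : (w + ((⟨3, 0⟩ : GaussianInt) : ℂ)).im = w.im := by simp
  obtain ⟨x, hx⟩ := exists_mul_eq_neg_one
    (w := w + ((⟨3, 0⟩ : GaussianInt) : ℂ)) (by rw [hre]; linarith)
  -- The inverted lens requires `re ± im ≥ 1`; on the open tile about 3 both quantities exceed 2.
  refine ⟨⟨3, 0⟩, ⟨1, rfl⟩, x, ?_, hx⟩
  rw [mem_noPiece_zero]
  have e1 := inversion_sq_le_iff hx (-1) (-1)
  have e2 := inversion_sq_le_iff hx (-1) 1
  rw [hre, him] at e1 e2
  refine ⟨inversion_mem_diamond hx ?_ ?_ ?_ ?_, ?_, ?_⟩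
  · rw [hre, him]; nlinarith
  · rw [hre, him]; nlinarith
  · rw [hre, him]; nlinarith
  · rw [hre, him]; nlinarith
  · linarith [e1.2 (by linarith)]
  · linarith [e2.2 (by linarith)]

/-- The inverted piece lies in the strip `0 ≤ re - im ≤ 1`. An open tile with centre `a` meets it
only if `a.re - a.im = 1`, and then only in its half `re ≤ im`. -/
theorem mem_oddTransfer_noPiece_one_iff {w : ℂ} (hw : w ∈ openDiamond) :
    w ∈ oddTransfer (noPiece 1) ↔ w.re ≤ w.im := by
  rw [mem_openDiamond_iff] at hw
  obtain ⟨w1, w2, w3, w4⟩ := hw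
  constructor
  · rintro ⟨a, ha, x, hxP, hx⟩
    rw [mem_noPiece_one] at hxP
    obtain ⟨-, h1, h2, h3⟩ := hxP
    have e1 := (inversion_le_sq_iff hx (-1) (-1)).1 (by linarith)
    have e2 := (inversion_linear_le_iff hx 1 1 0).1 (by linarith)
    simp only [add_re, add_im, ← GaussianInt.intCast_re,
      ← GaussianInt.intCast_im] at e1 e2
    have k1 : -1 < a.re - a.im := by
      have : ((-1 : ℤ) : ℝ) < ((a.re - a.im : ℤ) : ℝ) := by push_cast; linarith
      exact_mod_cast this
    -- `a.re - a.im` has the parity of `a.re + a.im`, hence is not 0.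
    have k2 : 1 ≤ a.re - a.im := by
      obtain ⟨k, hk⟩ := ha
      omega
    have k3 : (1 : ℝ) ≤ a.re - a.im := by exact_mod_cast k2
    linarith
  · intro h
    -- The centre `2 + i` has `re - im = 1`, and its tile satisfies `im ≥ 0`, as the inverted piece
    -- demands; the tile about 1 does not.
    have hre : (w + ((⟨2, 1⟩ : GaussianInt) : ℂ)).re = w.re + 2 := by simp
    have him : (w + ((⟨2, 1⟩ : GaussianInt) : ℂ)).im = w.im + 1 := by simp
    obtain ⟨x, hx⟩ := exists_mul_eq_neg_one
      (w := w + ((⟨2, 1⟩ : GaussianInt) : ℂ)) (by rw [hre]; linarith)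
    refine ⟨⟨2, 1⟩, ⟨1, rfl⟩, x, ?_, hx⟩
    rw [mem_noPiece_one]
    have e1 := inversion_le_sq_iff hx (-1) (-1)
    have e2 := inversion_linear_le_iff hx 0 (-1) 0
    have e3 := inversion_linear_le_iff hx 1 1 0
    rw [hre, him] at e1 e2 e3
    refine ⟨inversion_mem_diamond hx ?_ ?_ ?_ ?_, ?_, ?_, ?_⟩
    · rw [hre, him]; nlinarith
    · rw [hre, him]; nlinarith
    · rw [hre, him]; nlinarith
    · rw [hre, him]; nlinarith
    · linarith [e1.2 (by linarith)]
    · linarith [e2.2 (by linarith)]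
    · linarith [e3.2 (by linarith)]

/-- Here the strip is `0 ≤ im - re ≤ 1`, and the tile about `1 + 2i` realises the half. -/
theorem mem_oddTransfer_noPiece_two_iff {w : ℂ} (hw : w ∈ openDiamond) :
    w ∈ oddTransfer (noPiece 2) ↔ w.im ≤ w.re := by
  rw [mem_openDiamond_iff] at hw
  obtain ⟨w1, w2, w3, w4⟩ := hw
  constructor
  · rintro ⟨a, ha, x, hxP, hx⟩
    rw [mem_noPiece_two] at hxP
    obtain ⟨-, h1, h2, h3⟩ := hxP
    have e1 := (inversion_le_sq_iff hx 1 1).1 (by linarith)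
    have e2 := (inversion_linear_le_iff hx (-1) (-1) 0).1 (by linarith)
    simp only [add_re, add_im, ← GaussianInt.intCast_re,
      ← GaussianInt.intCast_im] at e1 e2
    have k1 : a.re - a.im < 1 := by
      have : ((a.re - a.im : ℤ) : ℝ) < ((1 : ℤ) : ℝ) := by push_cast; linarith
      exact_mod_cast this
    have k2 : a.re - a.im ≤ -1 := by
      obtain ⟨k, hk⟩ := ha
      omega
    have k3 : (a.re - a.im : ℝ) ≤ -1 := by exact_mod_cast k2
    linarith
  · intro h
    have hre : (w + ((⟨1, 2⟩ : GaussianInt) : ℂ)).re = w.re + 1 := by simp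
    have him : (w + ((⟨1, 2⟩ : GaussianInt) : ℂ)).im = w.im + 2 := by simp
    obtain ⟨x, hx⟩ := exists_mul_eq_neg_one
      (w := w + ((⟨1, 2⟩ : GaussianInt) : ℂ)) (by rw [hre]; linarith)
    refine ⟨⟨1, 2⟩, ⟨1, rfl⟩, x, ?_, hx⟩
    rw [mem_noPiece_two]
    have e1 := inversion_le_sq_iff hx 1 1
    have e2 := inversion_linear_le_iff hx (-1) (-1) 0
    have e3 := inversion_linear_le_iff hx 1 0 0
    rw [hre, him] at e1 e2 e3
    refine ⟨inversion_mem_diamond hx ?_ ?_ ?_ ?_, ?_, ?_, ?_⟩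
    · rw [hre, him]; nlinarith
    · rw [hre, him]; nlinarith
    · rw [hre, him]; nlinarith
    · rw [hre, him]; nlinarith
    · linarith [e1.2 (by linarith)]
    · linarith [e2.2 (by linarith)]
    · linarith [e3.2 (by linarith)]

/-- Replacing `x` by `I * x` and `w + a` by `-I * (w + a)` keeps the product `-1`, and units
preserve oddness. -/
theorem mem_oddTransfer_noPiece_add_three_iff (n : ℕ) (w : ℂ) :
    w ∈ oddTransfer (noPiece (n + 3)) ↔ -I * w ∈ oddTransfer (noPiece n) := by
  constructor
  · rintro ⟨a, ha, x, hx, h⟩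
    refine ⟨⟨a.im, -a.re⟩, ?_, I * x, (mem_noPiece_add_three n x).1 hx, ?_⟩
    · obtain ⟨k, hk⟩ := ha
      exact ⟨a.im - k - 1, by simp only; omega⟩
    · have ea : (((⟨a.im, -a.re⟩ : GaussianInt)) : ℂ) = -I * (a : ℂ) := by
        apply Complex.ext <;> simp
      rw [ea, ← h]
      linear_combination -x * (w + a) * I_mul_I
  · rintro ⟨a, ha, x, hx, h⟩
    refine ⟨⟨-a.im, a.re⟩, ?_, -I * x, ?_, ?_⟩
    · obtain ⟨k, hk⟩ := ha
      exact ⟨k - a.im, by simp only; omega⟩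
    · rw [mem_noPiece_add_three]
      rwa [show I * (-I * x) = x by linear_combination -x * I_mul_I]
    · have ea : (((⟨-a.im, a.re⟩ : GaussianInt)) : ℂ) = I * (a : ℂ) := by
        apply Complex.ext <;> simp
      rw [ea, ← h]
      linear_combination -x * a * I_mul_I

theorem exists_oddTransfer_noPiece_iff (n : ℕ) :
    ∃ J : Set ℕ, ∀ w ∈ openDiamond, w ∈ oddTransfer (noPiece n) ↔ ∃ j ∈ J, w ∈ noPiece j := by
  induction n using noPiece.induct with
  | case1 =>
    refine ⟨Set.univ, fun w hw =>
      ⟨fun _ => ?_, fun _ => openDiamond_subset_oddTransfer_noPiece_zero hw⟩⟩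
    simpa using exists_mem_noPiece (openDiamond_subset_diamond hw)
  | case2 =>
    refine ⟨{0, 1, 2, 3, 4, 11}, fun w hw => (mem_oddTransfer_noPiece_one_iff hw).trans
      ⟨mem_iUnion_noPiece_of_re_le_im (openDiamond_subset_diamond hw), ?_⟩⟩
    rintro ⟨j, hj, h⟩
    exact re_le_im_of_mem_noPiece hj h
  | case3 =>
    refine ⟨{5, 6, 7, 8, 9, 10}, fun w hw => (mem_oddTransfer_noPiece_two_iff hw).trans
      ⟨mem_iUnion_noPiece_of_im_le_re (openDiamond_subset_diamond hw), ?_⟩⟩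
    rintro ⟨j, hj, h⟩
    exact im_le_re_of_mem_noPiece hj h
  | case4 n ih =>
    obtain ⟨J, hJ⟩ := ih
    -- The shift by 9 is the inverse of the shift by 3 modulo 12; indices beyond 11 are harmless by
    -- periodicity.
    refine ⟨(· + 9) '' J, fun w hw => ?_⟩
    have hw' : -I * w ∈ openDiamond := by
      rw [mem_openDiamond_iff] at *
      simp only [neg_mul, neg_re, neg_im, I_mul_re, I_mul_im]
      grind
    rw [mem_oddTransfer_noPiece_add_three_iff, hJ _ hw', Set.exists_mem_image]
    simp only [mem_noPiece_add_nine]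

theorem IsNearestOdd.isBuildable {c : ℂ → GaussianInt} (hc : IsNearestOdd c) (n : ℕ) :
    IsBuildable (Set.range noPartition) (gaussMap c '' noPiece n) := by
  obtain ⟨J, hJ⟩ := exists_oddTransfer_noPiece_iff n
  refine ⟨noPiece '' J, ?_, ?_⟩
  · rintro _ ⟨j, -, rfl⟩
    exact noPiece_mem_range_noPartition j
  -- Off this null set a point lies either in the open diamond, where the transfer description
  -- applies, or outside the diamond, where neither set has points.
  · have hnull : volume (diamond \ openDiamond ∪ {0}) = 0 :=
      measure_union_null volume_diamond_diff_openDiamond (measure_singleton 0)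
    rw [← compl_mem_ae_iff] at hnull
    refine Filter.eventuallyEq_set.2 ?_
    filter_upwards [hnull] with w hw
    rw [Set.sUnion_image]
    simp only [Set.mem_iUnion, exists_prop]
    simp only [Set.mem_compl_iff, Set.mem_union, Set.mem_sdiff, Set.mem_singleton_iff] at hw
    by_cases hwU : w ∈ openDiamond
    · rw [hc.mem_gaussMap_image_iff _ hwU (by tauto), hJ w hwU]
    · have hwK : w ∉ diamond := by tauto
      constructor
      · rintro ⟨x, -, rfl⟩
        exact absurd (hc.gaussMap_mem_diamond x) hwK
      · rintro ⟨j, -, hj⟩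
        exact absurd (noPiece_subset_diamond j hj) hwK

/-! ### The pieces form a partition -/

theorem isClosed_disc (p : ℂ) (r : ℝ) : IsClosed {z : ℂ | ‖z - p‖ ≤ r} :=
  isClosed_le (by fun_prop) (by fun_prop)

theorem isClosed_disc_exterior (p : ℂ) (r : ℝ) : IsClosed {z : ℂ | r ≤ ‖z - p‖} :=
  isClosed_le (by fun_prop) (by fun_prop)

theorem isClosed_halfPlane (f g : ℂ →L[ℝ] ℝ) : IsClosed {z : ℂ | f z ≤ g z} :=
  isClosed_le (by fun_prop) (by fun_prop)

theorem isClosed_noPiece (n : ℕ) : IsClosed (noPiece n) := by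
  induction n using noPiece.induct with
  | case1 => exact isClosed_diamond.inter ((isClosed_disc _ _).inter (isClosed_disc _ _))
  | case2 =>
    exact isClosed_diamond.inter ((isClosed_disc_exterior _ _).inter
      ((isClosed_halfPlane 0 imCLM).inter (isClosed_halfPlane imCLM (-reCLM))))
  | case3 =>
    exact isClosed_diamond.inter ((isClosed_disc_exterior _ _).inter
      ((isClosed_halfPlane (-imCLM) reCLM).inter (isClosed_halfPlane reCLM 0)))
  | case4 n ih =>
    have : noPiece (n + 3) = (fun z => I * z) ⁻¹' noPiece n :=
      Set.ext fun z => mem_noPiece_add_three n z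
    rw [this]
    exact ih.preimage (by fun_prop)

/-- Multiplication by `I` as a linear isometry. -/
noncomputable def mulI : ℂ ≃ₗᵢ[ℝ] ℂ := rotation ⟨I, by simp [Submonoid.unitSphere]⟩

theorem noPiece_add_three_eq (n : ℕ) : noPiece (n + 3) = mulI ⁻¹' noPiece n :=
  Set.ext fun z => mem_noPiece_add_three n z

theorem volume_frontier_inter_null {A B : Set ℂ} (hA : volume (frontier A) = 0)
    (hB : volume (frontier B) = 0) : volume (frontier (A ∩ B)) = 0 :=
  measure_mono_null (frontier_inter_subset A B) (measure_union_null
    (measure_mono_null Set.inter_subset_left hA) (measure_mono_null Set.inter_subset_right hB))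

theorem volume_frontier_disc (p : ℂ) (r : ℝ) : volume (frontier {z : ℂ | ‖z - p‖ ≤ r}) = 0 := by
  have : {z : ℂ | ‖z - p‖ ≤ r} = Metric.closedBall p r := by
    ext z
    simp [dist_eq_norm]
  rw [this]
  exact (convex_closedBall p r).addHaar_frontier volume

theorem volume_frontier_disc_exterior (p : ℂ) (r : ℝ) :
    volume (frontier {z : ℂ | r ≤ ‖z - p‖}) = 0 := by
  have : {z : ℂ | r ≤ ‖z - p‖} = (Metric.ball p r)ᶜ := by
    ext z
    simp [dist_eq_norm]
  rw [this, frontier_compl]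
  exact (convex_ball p r).addHaar_frontier volume

theorem volume_frontier_halfPlane (f g : ℂ →ₗ[ℝ] ℝ) :
    volume (frontier {z : ℂ | f z ≤ g z}) = 0 := by
  have : {z : ℂ | f z ≤ g z} = {z : ℂ | (f - g) z ≤ 0} := by
    ext z
    simp
  rw [this]
  exact (convex_halfSpace_le (f - g).isLinear 0).addHaar_frontier volume

/-- Each basic piece is a finite intersection of convex sets and complements of convex sets, whose
frontiers are null; isometries carry this over to the rotated pieces. -/
theorem volume_frontier_noPiece (n : ℕ) : volume (frontier (noPiece n)) = 0 := by
  have hd : volume (frontier diamond) = 0 := convex_diamond.addHaar_frontier volume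
  induction n using noPiece.induct with
  | case1 =>
    exact volume_frontier_inter_null hd
      (volume_frontier_inter_null (volume_frontier_disc _ _) (volume_frontier_disc _ _))
  | case2 =>
    exact volume_frontier_inter_null hd
      (volume_frontier_inter_null (volume_frontier_disc_exterior _ _)
        (volume_frontier_inter_null (volume_frontier_halfPlane 0 imLm)
          (volume_frontier_halfPlane imLm (-reLm))))
  | case3 =>
    exact volume_frontier_inter_null hd
      (volume_frontier_inter_null (volume_frontier_disc_exterior _ _)
        (volume_frontier_inter_null (volume_frontier_halfPlane (-imLm) reLm)
          (volume_frontier_halfPlane reLm 0)))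
  | case4 n ih =>
    rw [noPiece_add_three_eq]
    have h := mulI.toHomeomorph.preimage_frontier (noPiece n)
    rw [LinearIsometryEquiv.coe_toHomeomorph] at h
    rw [← h, mulI.measurePreserving.measure_preimage isClosed_frontier.nullMeasurableSet, ih]

theorem interior_noPiece_nonempty (n : ℕ) : (interior (noPiece n)).Nonempty := by
  induction n using noPiece.induct with
  | case1 =>
    refine ⟨⟨-1 / 2, 0⟩, mem_interior.2 ⟨openDiamond ∩
      ({z | z.re ^ 2 + z.im ^ 2 < -z.re - z.im} ∩ {z | z.re ^ 2 + z.im ^ 2 < -z.re + z.im}),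
      ?_, ?_, ?_⟩⟩
    · rintro z ⟨h1, h2, h3⟩
      exact (mem_noPiece_zero z).2 ⟨openDiamond_subset_diamond h1, le_of_lt h2, le_of_lt h3⟩
    · exact isOpen_openDiamond.inter ((isOpen_lt (by fun_prop) (by fun_prop)).inter
        (isOpen_lt (by fun_prop) (by fun_prop)))
    · refine ⟨(mem_openDiamond_iff _).2 ?_, ?_, ?_⟩ <;> norm_num
  | case2 =>
    refine ⟨⟨-1 / 2, 2 / 5⟩, mem_interior.2 ⟨openDiamond ∩
      ({z | -z.re - z.im < z.re ^ 2 + z.im ^ 2} ∩ ({z | 0 < z.im} ∩ {z | z.im < -z.re})),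
      ?_, ?_, ?_⟩⟩
    · rintro z ⟨h1, h2, h3, h4⟩
      exact (mem_noPiece_one z).2
        ⟨openDiamond_subset_diamond h1, le_of_lt h2, le_of_lt h3, le_of_lt h4⟩
    · exact isOpen_openDiamond.inter ((isOpen_lt (by fun_prop) (by fun_prop)).inter
        ((isOpen_lt (by fun_prop) (by fun_prop)).inter
          (isOpen_lt (by fun_prop) (by fun_prop))))
    · refine ⟨(mem_openDiamond_iff _).2 ?_, ?_, ?_, ?_⟩ <;> norm_num
  | case3 =>
    refine ⟨⟨-2 / 5, 1 / 2⟩, mem_interior.2 ⟨openDiamond ∩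
      ({z | z.re + z.im < z.re ^ 2 + z.im ^ 2} ∩ ({z | -z.im < z.re} ∩ {z | z.re < 0})),
      ?_, ?_, ?_⟩⟩
    · rintro z ⟨h1, h2, h3, h4⟩
      exact (mem_noPiece_two z).2
        ⟨openDiamond_subset_diamond h1, le_of_lt h2, le_of_lt h3, le_of_lt h4⟩
    · exact isOpen_openDiamond.inter ((isOpen_lt (by fun_prop) (by fun_prop)).inter
        ((isOpen_lt (by fun_prop) (by fun_prop)).inter
          (isOpen_lt (by fun_prop) (by fun_prop))))
    · refine ⟨(mem_openDiamond_iff _).2 ?_, ?_, ?_, ?_⟩ <;> norm_num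
  | case4 n ih =>
    rw [noPiece_add_three_eq]
    have h := mulI.toHomeomorph.preimage_interior (noPiece n)
    rw [LinearIsometryEquiv.coe_toHomeomorph] at h
    rw [← h]
    exact ih.preimage mulI.surjective

/-! ### Null boundary curves and disjoint interiors -/

theorem volume_line_eq_zero (a b : ℝ) (h : a ≠ 0 ∨ b ≠ 0) :
    volume {z : ℂ | a * z.re + b * z.im = 0} = 0 := by
  have : {z : ℂ | a * z.re + b * z.im = 0} = (LinearMap.ker (a • reLm + b • imLm) : Set ℂ) := by
    ext z
    simp
  rw [this]
  refine Measure.addHaar_submodule volume _ fun htop => ?_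
  have h1 : (1 : ℂ) ∈ LinearMap.ker (a • reLm + b • imLm) := htop ▸ Submodule.mem_top
  have h2 : I ∈ LinearMap.ker (a • reLm + b • imLm) := htop ▸ Submodule.mem_top
  simp at h1 h2
  tauto

theorem volume_circle_eq_zero (p : ℂ) (hp : p.re ^ 2 + p.im ^ 2 = 2) :
    volume {z : ℂ | z.re ^ 2 + z.im ^ 2 = p.re * z.re + p.im * z.im} = 0 := by
  have : {z : ℂ | z.re ^ 2 + z.im ^ 2 = p.re * z.re + p.im * z.im} =
      Metric.sphere (p / 2) (1 / √2) := by
    ext z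
    rw [Set.mem_ofPred_eq, mem_sphere_iff_norm, le_antisymm_iff, le_antisymm_iff,
      norm_sub_half_le_iff z p hp, le_norm_sub_half_iff z p hp]
  rw [this]
  exact Measure.addHaar_sphere volume _ _

/-- Almost every point lies on none of the lines and circles that bound the pieces. -/
theorem ae_off_boundaries : ∀ᵐ z : ℂ, (z.re ≠ 0 ∧ z.im ≠ 0 ∧ z.re ≠ z.im ∧ z.re ≠ -z.im) ∧
    z.re ^ 2 + z.im ^ 2 ≠ z.re + z.im ∧ z.re ^ 2 + z.im ^ 2 ≠ z.re - z.im ∧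
    z.re ^ 2 + z.im ^ 2 ≠ -z.re + z.im ∧ z.re ^ 2 + z.im ^ 2 ≠ -z.re - z.im := by
  have l : ∀ a b : ℝ, (a ≠ 0 ∨ b ≠ 0) → ∀ᵐ z : ℂ, a * z.re + b * z.im ≠ 0 := fun a b h =>
    ae_iff.2 (by simpa using volume_line_eq_zero a b h)
  have s : ∀ p : ℂ, p.re ^ 2 + p.im ^ 2 = 2 →
      ∀ᵐ z : ℂ, z.re ^ 2 + z.im ^ 2 ≠ p.re * z.re + p.im * z.im := fun p h =>
    ae_iff.2 (by simpa using volume_circle_eq_zero p h)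
  filter_upwards [l 1 0 (by simp), l 0 1 (by simp), l 1 (-1) (by simp), l 1 1 (by simp),
    s ⟨1, 1⟩ (by norm_num), s ⟨1, -1⟩ (by norm_num), s ⟨-1, 1⟩ (by norm_num),
    s ⟨-1, -1⟩ (by norm_num)] with z l1 l2 l3 l4 s1 s2 s3 s4
  refine ⟨⟨fun h => l1 ?_, fun h => l2 ?_, fun h => l3 ?_, fun h => l4 ?_⟩, fun h => s1 ?_,
    fun h => s2 ?_, fun h => s3 ?_, fun h => s4 ?_⟩ <;> linarith

/-- For every pair of pieces the defining inequalities, together with nonnegativity of squares,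
force equality on one of the eight boundary curves. -/
theorem noPiece_disjoint_off_boundaries {z : ℂ}
    (hl : z.re ≠ 0 ∧ z.im ≠ 0 ∧ z.re ≠ z.im ∧ z.re ≠ -z.im)
    (hs : z.re ^ 2 + z.im ^ 2 ≠ z.re + z.im ∧ z.re ^ 2 + z.im ^ 2 ≠ z.re - z.im ∧
      z.re ^ 2 + z.im ^ 2 ≠ -z.re + z.im ∧ z.re ^ 2 + z.im ^ 2 ≠ -z.re - z.im)
    {i j : ℕ} (hij : i < j) (hj12 : j < 12) (hi : z ∈ noPiece i) (hj : z ∈ noPiece j) : False := by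
  have h1 := sq_nonneg z.re
  have h2 := sq_nonneg z.im
  obtain ⟨l1, l2, l3, l4⟩ := hl
  obtain ⟨s1, s2, s3, s4⟩ := hs
  interval_cases j <;> interval_cases i
  all_goals
    simp only [mem_noPiece_add_three 0, mem_noPiece_add_three 1, mem_noPiece_add_three 2,
      mem_noPiece_add_three 3, mem_noPiece_add_three 4, mem_noPiece_add_three 5,
      mem_noPiece_add_three 6, mem_noPiece_add_three 7, mem_noPiece_add_three 8,
      mem_noPiece_zero, mem_noPiece_one, mem_noPiece_two, I_mul_re, I_mul_im, neg_sq,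
      neg_neg] at hi hj
    obtain ⟨-, a1, a2⟩ := hi
    obtain ⟨-, b1, b2⟩ := hj
    first
    | exact l1 (by linarith)
    | exact l2 (by linarith)
    | exact l3 (by linarith)
    | exact l4 (by linarith)
    | exact s1 (by linarith)
    | exact s2 (by linarith)
    | exact s3 (by linarith)
    | exact s4 (by linarith)

theorem isFinitePartition_noPartition : IsFinitePartition diamond noPartition where
  iUnion_eq := by
    refine subset_antisymm (Set.iUnion_subset fun i => noPiece_subset_diamond i) fun z hz => ?_
    obtain ⟨n, hn⟩ := exists_mem_noPiece hz
    obtain ⟨i, hi⟩ := noPiece_mem_range_noPartition n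
    exact Set.mem_iUnion.2 ⟨i, hi ▸ hn⟩
  isClosed i := isClosed_noPiece i
  frontier_null i := volume_frontier_noPiece i
  interior_nonempty i := interior_noPiece_nonempty i
  interior_disjoint i j hij := by
    rw [Set.disjoint_iff_inter_eq_empty]
    -- An open null set is empty, so it is enough that the overlap lies on the boundary curves.
    refine (isOpen_interior.inter isOpen_interior).eq_empty_of_measure_zero (μ := volume) ?_
    refine measure_mono_null (fun z hz => ?_) (ae_iff.1 ae_off_boundaries)
    intro h
    have hi := interior_subset hz.1
    have hj := interior_subset hz.2
    rcases hij.lt_or_gt with hlt | hlt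
    · exact noPiece_disjoint_off_boundaries h.1 h.2 hlt j.2 hi hj
    · exact noPiece_disjoint_off_boundaries h.1 h.2 hlt i.2 hj hi

end ComplexCF

theorem mainTheorem9 (c : ℂ → GaussianInt) (hc : ComplexCF.IsNearestOdd c) :
    ComplexCF.fundamentalSet c = ComplexCF.diamond ∧
      ComplexCF.FiniteBuildingPropertyWith c ComplexCF.noPartition := by
  refine ⟨hc.fundamentalSet_eq, hc.isChoiceFunction, ?_, by norm_num, ?_,
    fun i => hc.isBuildable i⟩
  · rw [hc.fundamentalSet_eq]
    exact fun z _ => hc.gaussMap_mem_diamond z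
  · rw [hc.fundamentalSet_eq]
    exact ComplexCF.isFinitePartition_noPartition
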